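/- **Conventions.** All alphabets are finite and discrete, and $\sigma$ is the shift $\sigma(x)_i=x_{i+1}$. A *subshift* is a closed subset $X$ of $A^{\mathbb Z}$ with $\sigma(X)=X$; it is a *subshift of finite type* (SFT) if it is the set of all sequences in which no word of some finite set of forbidden words occurs. A *sliding block code* $\varphi:X\to Y$ is a map for which there are $m,n\in\mathbb N$ and a map $\Phi$ on the words of length $m+n+1$ of $X$ with $\varphi(x)_i=\Phi(x_{i-m}\cdots x_{i+n})$ for all $x\in X$, $i\in\mathbb Z$. A *factor map* is a surjective sliding block code, and a *conjugacy* is a sliding block code having an inverse that is a sliding block code. Maps $\pi:X\to Y$ and $\pi':X'\to Y$ are *isomorphic* if $\pi'\circ\chi=\pi$ for some conjugacy $\chi:X\to X'$. For $x\in X$ put $\mathbb U(x)=\{z\in X:\ \exists N\in\mathbb Z\ \forall i\le N,\ z_i=x_i\}$. Let $\pi:X\to Y$ be a sliding block code. A point $x\in X$ is *regular* for $\pi$ if $\pi:\mathbb U(x)\to\mathbb U(\pi(x))$ is surjective; $\mathcal R(\pi)$ denotes the set of regular points, and $\pi$ is *regular* if $\mathcal R(\pi)$ is dense in $X$. The map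 $\pi$ is *right-closing* if $x=x'$ whenever $x'\in\mathbb U(x)$ and $\pi(x)=\pi(x')$. For a subshift $Y\subseteq A^{\mathbb Z}$ and $y\in Y$ let $F(y)=\{z_{[0,\infty)}:\ z\in Y,\ z_j=y_j \text{ for all } j\le -1\}$. For $D\subseteq A^{\mathbb N}$ and $a\in A$ let $\frac{D}{a}=\{x\in A^{\mathbb N}:\ ax\in D\}$. The labeled graph $\mathbb K(Y)$ has vertex set $\{F(y):y\in Y\}$ and exactly one arrow labeled $a$ from $F(y)$ to $F(z)$ if $F(z)=\frac{F(y)}{a}$, and none otherwise. Let $X_{\mathbb K(Y)}$ be its edge shift, i.e. the set of bi-infinite paths. The *future cover* of $Y$ is the map $L_{\mathbb K(Y)}:X_{\mathbb K(Y)}\to Y$ that reads the labels along a path. **Proposition 3.9.** Let $\pi:X\to Y$ be a factor map between subshifts, with $X$ an SFT. Then $\pi$ is isomorphic to the future cover $L_{\mathbb K(Y)}:X_{\mathbb K(Y)}\to Y$ if and only if a) $\pi$ is regular, b) $\pi$ is right-closing, c) $\pi$ is injective on $\mathcal R(\pi)$, and d) $\pi$ is minimal with respect to regular and right-closing factor maps: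 for every SFT $X'$ and every regular, right-closing factor map $\pi':X'\to Y$ there is a sliding block code $\rho:X'\to X$ with $\pi\circ\rho=\pi'$. -/

import Mathlib

open SymbolicDynamics.FullShift

universe u

namespace FutureCover

/-! ### Subshifts of finite type, sliding block codes, factor maps -/

section Codes

variable {A B C : Type u} [TopologicalSpace A] [TopologicalSpace B] [TopologicalSpace C]

/-- The finite word `w` occurs somewhere in the bi-infinite sequence `x`. -/
def Occurs {A : Type u} (w : List A) (x : ℤ → A) : Prop :=
  ∃ i : ℤ, ∀ k : Fin w.length, x (i + (k : ℕ)) = w.get k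

/-- A subshift is of finite type when it is the set of all bi-infinite sequences in which no word
from some finite set `F` of forbidden words occurs. -/
def IsSFT (X : Subshift A ℤ) : Prop :=
  ∃ F : Set (List A), F.Finite ∧ X.carrier = {x | ∀ w ∈ F, ¬ Occurs w x}

/-- The block `x_i x_{i+1} ⋯ x_{i+n-1}`. -/
def block {A : Type u} (x : ℤ → A) (i : ℤ) (n : ℕ) : Fin n → A := fun k => x (i + (k : ℕ))

/-- The words of length `n` of a subshift. -/
def wordsOfLength (X : Subshift A ℤ) (n : ℕ) : Set (Fin n → A) :=
  {w | ∃ x ∈ X.carrier, ∃ i : ℤ, block x i n = w}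

/-- `φ : X → Y` is a sliding block code: for some memory `m`, anticipation `n` and block map `Φ`
on the words of length `m + n + 1` of `X`, one has `φ(x)_i = Φ(x_{i-m} ⋯ x_{i+n})` for all
`x` and `i`. -/
def IsSlidingBlockCode {X : Subshift A ℤ} {Y : Subshift B ℤ} (φ : X.carrier → Y.carrier) : Prop :=
  ∃ (m n : ℕ) (Φ : wordsOfLength X (m + n + 1) → B), ∀ (x : X.carrier) (i : ℤ),
    (φ x).1 i = Φ ⟨block x.1 (i - m) (m + n + 1), x.1, x.2, i - m, rfl⟩

/-- A factor map (factor code) is a surjective sliding block code. -/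
def IsFactorMap {X : Subshift A ℤ} {Y : Subshift B ℤ} (φ : X.carrier → Y.carrier) : Prop :=
  IsSlidingBlockCode φ ∧ Function.Surjective φ

/-- A conjugacy is a sliding block code with an inverse that is a sliding block code. -/
def IsConjugacy {X : Subshift A ℤ} {Y : Subshift B ℤ} (φ : X.carrier → Y.carrier) : Prop :=
  IsSlidingBlockCode φ ∧ ∃ ψ : Y.carrier → X.carrier,
    IsSlidingBlockCode ψ ∧ Function.LeftInverse ψ φ ∧ Function.RightInverse ψ φ

/-- Two maps `π : X → Y`, `π' : X' → Y` onto the same subshift are isomorphic when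
`π' ∘ χ = π` for some conjugacy `χ : X → X'`. -/
def AreIsomorphic {X : Subshift A ℤ} {X' : Subshift B ℤ} {Y : Subshift C ℤ}
    (π : X.carrier → Y.carrier) (π' : X'.carrier → Y.carrier) : Prop :=
  ∃ χ : X.carrier → X'.carrier, IsConjugacy χ ∧ π' ∘ χ = π

/-- The unstable set `𝕌(x)`: the elements of `X` that agree with `x` on some left half-line. -/
def unstableSet {X : Subshift A ℤ} (x : X.carrier) : Set X.carrier :=
  {z | ∃ N : ℤ, ∀ i ≤ N, z.1 i = x.1 i}

/-- The set `𝓡(π)` of regular points: those `x` with `π : 𝕌(x) → 𝕌(π(x))` surjective. -/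
def regularPoints {X : Subshift A ℤ} {Y : Subshift B ℤ} (π : X.carrier → Y.carrier) :
    Set X.carrier :=
  {x | Set.SurjOn π (unstableSet x) (unstableSet (π x))}

/-- `π` is regular when its regular points are dense in `X`. -/
def IsRegular {X : Subshift A ℤ} {Y : Subshift B ℤ} (π : X.carrier → Y.carrier) : Prop :=
  Dense (regularPoints π)

/-- `π` is right-closing: left-asymptotic points with the same image are equal. -/
def IsRightClosing {X : Subshift A ℤ} {Y : Subshift B ℤ} (π : X.carrier → Y.carrier) : Prop :=
  ∀ x x' : X.carrier, (∃ N : ℤ, ∀ i ≤ N, x.1 i = x'.1 i) → π x = π x' → x = x'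

/-- `π : X → Y` is minimal with respect to regular and right-closing factor maps: every regular
right-closing factor map onto `Y` from a subshift of finite type factors through `π` by a sliding
block code. -/
def IsMinimalAmongRegularRightClosing {X : Subshift A ℤ} {Y : Subshift B ℤ}
    (π : X.carrier → Y.carrier) : Prop :=
  ∀ (D : Type u) [Finite D] [TopologicalSpace D] [DiscreteTopology D] (X' : Subshift D ℤ)
    (π' : X'.carrier → Y.carrier), IsSFT X' → IsFactorMap π' → IsRegular π' → IsRightClosing π' →
      ∃ ρ : X'.carrier → X.carrier, IsSlidingBlockCode ρ ∧ π ∘ ρ = π'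

end Codes

/-! ### Labeled graphs and their edge shifts -/

/-- A directed graph with a labeling of its edges by `A`. -/
structure LabeledGraph (A : Type u) where
  /-- vertexes -/
  V : Type u
  /-- edges -/
  E : Type u
  /-- start vertex of an edge -/
  s : E → V
  /-- terminal vertex of an edge -/
  t : E → V
  /-- label of an edge -/
  L : E → A

/-- The set of edges, as the alphabet of the edge shift, is discrete. -/
instance LabeledGraph.instTopE {A : Type u} (G : LabeledGraph A) : TopologicalSpace G.E := ⊥

instance LabeledGraph.instDiscreteE {A : Type u} (G : LabeledGraph A) : DiscreteTopology G.E :=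
  ⟨rfl⟩

/-- The edge shift of a graph: the bi-infinite paths. -/
def LabeledGraph.edgeShift {A : Type u} (G : LabeledGraph A) : Subshift G.E ℤ where
  carrier := {e | ∀ i : ℤ, G.s (e (i + 1)) = G.t (e i)}
  isClosed := by
    have h : ∀ i : ℤ, IsClosed {e : ℤ → G.E | G.s (e (i + 1)) = G.t (e i)} := by
      intro i
      have h' : IsClosed {p : G.E × G.E | G.s p.1 = G.t p.2} := isClosed_discrete _
      exact h'.preimage (f := fun e : ℤ → G.E => (e (i + 1), e i)) (by fun_prop)
    simpa only [Set.ofPred_forall] using isClosed_iInter h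
  mapsTo := by
    intro g e he i
    have := he (g + i)
    simpa [shift_apply, add_assoc] using this

/-! ### The future cover -/

section Cover

variable {A : Type u} [TopologicalSpace A]

/-- The follower set `F(y) = {z_{[0,∞)} : z ∈ Y, z_j = y_j for j ≤ -1}`. -/
def followerSet (Y : Subshift A ℤ) (y : ℤ → A) : Set (ℕ → A) :=
  {w | ∃ z ∈ Y.carrier, (∀ j : ℤ, j ≤ -1 → z j = y j) ∧ ∀ n : ℕ, z n = w n}

/-- `D / a = {x : a x ∈ D}`, where `a x` is the sequence `a x₀ x₁ x₂ ⋯`. -/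
def letterQuotient {A : Type u} (D : Set (ℕ → A)) (a : A) : Set (ℕ → A) :=
  {x | (fun n : ℕ => Nat.casesOn n a x) ∈ D}

/-- The labeled graph `𝕂(Y)`: its vertexes are the follower sets `F(y)`, `y ∈ Y`, and there is one
arrow from `F(y)` to `F(z)` labeled `a` precisely when `F(z) = F(y) / a`.
It is a finite graph when `Y` is sofic. -/
def futureGraph (Y : Subshift A ℤ) : LabeledGraph A where
  V := {D : Set (ℕ → A) // ∃ y ∈ Y.carrier, followerSet Y y = D}
  E := {e : {D : Set (ℕ → A) // ∃ y ∈ Y.carrier, followerSet Y y = D} × A ×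
        {D : Set (ℕ → A) // ∃ y ∈ Y.carrier, followerSet Y y = D} //
        e.2.2.1 = letterQuotient e.1.1 e.2.1}
  s := fun e => e.1.1
  t := fun e => e.1.2.2
  L := fun e => e.1.2.1

/-- Reading `n` labels along a path in `𝕂(Y)` and continuing with an element of the vertex reached
gives an element of the vertex where the path started. -/
theorem exists_mem_vertex (Y : Subshift A ℤ) (e : ℤ → (futureGraph Y).E)
    (he : e ∈ (futureGraph Y).edgeShift.carrier) (n : ℕ) :
    ∀ i : ℤ, ∃ w ∈ ((futureGraph Y).s (e i)).1,
      ∀ k : ℕ, k < n → w k = (futureGraph Y).L (e (i + k)) := by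
  induction n with
  | zero =>
    intro i
    obtain ⟨y, hy, h⟩ := ((futureGraph Y).s (e i)).2
    refine ⟨fun n => y n, ?_, fun k hk => absurd hk (Nat.not_lt_zero k)⟩
    rw [← h]
    exact ⟨y, hy, fun _ _ => rfl, fun _ => rfl⟩
  | succ n ih =>
    intro i
    obtain ⟨w, hw, hk⟩ := ih (i + 1)
    rw [he i] at hw
    have hE : ((futureGraph Y).t (e i)).1
        = letterQuotient ((futureGraph Y).s (e i)).1 ((futureGraph Y).L (e i)) := (e i).2
    rw [hE] at hw
    refine ⟨_, hw, ?_⟩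
    intro k hkn
    cases k with
    | zero => simp
    | succ k =>
      have := hk k (by omega)
      simp only [this]
      congr 2
      push_cast
      ring

/-- The label sequence of a bi-infinite path in `𝕂(Y)` belongs to `Y`. -/
theorem label_mem [DiscreteTopology A] (Y : Subshift A ℤ) (e : ℤ → (futureGraph Y).E)
    (he : e ∈ (futureGraph Y).edgeShift.carrier) :
    (fun i => (futureGraph Y).L (e i)) ∈ Y.carrier := by
  have key : ∀ N : ℕ, ∃ z ∈ Y.carrier, ∀ i : ℤ, -N ≤ i → i < N →
      z i = (futureGraph Y).L (e i) := by
    intro N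
    obtain ⟨w, hw, hk⟩ := exists_mem_vertex Y e he (N + N) (-N)
    obtain ⟨y, -, hy⟩ := ((futureGraph Y).s (e (-N))).2
    rw [← hy] at hw
    obtain ⟨z, hz, -, hzw⟩ := hw
    refine ⟨shift (N : ℤ) z, Y.mapsTo _ hz, fun i h1 h2 => ?_⟩
    obtain ⟨k, hk'⟩ := Int.eq_ofNat_of_zero_le (show 0 ≤ (N : ℤ) + i by omega)
    have h3 := hk k (by omega)
    rw [shift_apply, hk', hzw k, h3]
    congr 2
    omega
  choose z hz hzi using key
  refine Y.isClosed.mem_of_tendsto (f := z) (b := Filter.atTop) ?_ (Filter.Eventually.of_forall hz)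
  rw [tendsto_pi_nhds]
  intro i
  refine tendsto_const_nhds.congr' ?_
  filter_upwards [Filter.eventually_ge_atTop (i.natAbs + 1)] with N hN
  exact (hzi N i (by omega) (by omega)).symm

/-- The future cover `L_{𝕂(Y)} : X_{𝕂(Y)} → Y`, reading labels along bi-infinite paths. -/
def futureCover [DiscreteTopology A] (Y : Subshift A ℤ) :
    (futureGraph Y).edgeShift.carrier → Y.carrier :=
  fun e => ⟨fun i => (futureGraph Y).L (e.1 i), label_mem Y e.1 e.2⟩

end Cover

end FutureCover

/-! The future cover has a canonical section, `followerPath`, sending `y` to the path through the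
follower sets of its left rays. Its regular points are exactly these canonical paths. Changing `y`
far to the right leaves the earlier vertices alone, so they are regular. Conversely, lifting all
continuations of a left ray forces each vertex of a regular path to be the full follower set
(`eq_followerPath_of_mem_regularPoints`). This gives c). Right-closing holds because a vertex and
the labels after it determine the path; density holds because any path agrees, from a given position
on, with a canonical one.

For d), let `π'` be regular and right-closing on an SFT. By `exists_followerSet_eq_of_window` the
follower set of the image of a regular point depends only on a window of that point. Approximating
arbitrary points by regular ones turns this into a block code into the path space.

Properties a)–d) pass along isomorphisms. Conversely, if `π` satisfies them, minimality of the cover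
and of `π` gives codes both ways over `Y`. Their composites preserve regular points and fibres, so
they fix regular points by c), and density makes them identities. -/

namespace FutureCover

/-! ### Sliding block codes by windows, gluing in SFTs, density and compactness. -/

section Windows

variable {A B C : Type u} [TopologicalSpace A] [TopologicalSpace B] [TopologicalSpace C]

/-- A map between subshifts is a sliding block code precisely when every coordinate of the image
depends, uniformly in the position, on a window of fixed radius. -/
theorem isSlidingBlockCode_iff {X : Subshift A ℤ} {Y : Subshift B ℤ}
    (φ : X.carrier → Y.carrier) :
    IsSlidingBlockCode φ ↔ ∃ K : ℕ, ∀ (x x' : X.carrier) (i i' : ℤ),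
      (∀ j : ℤ, -K ≤ j → j ≤ K → x.1 (i + j) = x'.1 (i' + j)) → (φ x).1 i = (φ x').1 i' := by
  constructor
  · rintro ⟨m, n, Φ, h⟩
    refine ⟨m + n, fun x x' i i' hxx => ?_⟩
    rw [h, h]
    congr 2
    funext k
    have hk := k.2
    have := hxx (-m + (k : ℕ)) (by push_cast; omega) (by push_cast; omega)
    simp only [block]
    convert this using 2 <;> ring
  · rintro ⟨K, h⟩
    choose x hx i hi using fun w : wordsOfLength X (K + K + 1) => w.2
    -- Each word is evaluated at the centre of one chosen occurrence; the window condition makes the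
    -- choice irrelevant.
    refine ⟨K, K, fun w => (φ ⟨x w, hx w⟩).1 (i w + K), fun y p => ?_⟩
    refine h _ _ _ _ fun j h1 h2 => ?_
    have := congrFun (hi ⟨block y.1 (p - K) (K + K + 1), y.1, y.2, p - K, rfl⟩)
      ⟨(j + K).toNat, by omega⟩
    simp only [block] at this
    have e : (((j + K).toNat : ℕ) : ℤ) = j + K := by omega
    rw [e] at this
    convert this.symm using 2 <;> ring

theorem IsSlidingBlockCode.comp {X : Subshift A ℤ} {Y : Subshift B ℤ} {Z : Subshift C ℤ}
    {ψ : Y.carrier → Z.carrier} {φ : X.carrier → Y.carrier}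
    (hψ : IsSlidingBlockCode ψ) (hφ : IsSlidingBlockCode φ) : IsSlidingBlockCode (ψ ∘ φ) := by
  rw [isSlidingBlockCode_iff] at *
  obtain ⟨K, hK⟩ := hψ
  obtain ⟨L, hL⟩ := hφ
  refine ⟨K + L, fun x x' i i' h => hK _ _ _ _ fun j h1 h2 => hL _ _ _ _ fun k h3 h4 => ?_⟩
  have := h (j + k) (by push_cast; omega) (by push_cast; omega)
  rwa [← add_assoc, ← add_assoc] at this

theorem isSlidingBlockCode_id {X : Subshift A ℤ} :
    IsSlidingBlockCode (id : X.carrier → X.carrier) :=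
  (isSlidingBlockCode_iff _).2 ⟨0, fun x x' i i' h => by simpa using h 0⟩

/-- The shift as a self-map of a subshift. -/
def translate {X : Subshift A ℤ} (k : ℤ) (x : X.carrier) : X.carrier :=
  ⟨shift k x.1, X.mapsTo k x.2⟩

@[simp] theorem translate_val {X : Subshift A ℤ} (k : ℤ) (x : X.carrier) (i : ℤ) :
    (translate k x).1 i = x.1 (k + i) := rfl

theorem IsSlidingBlockCode.translate {X : Subshift A ℤ} {Y : Subshift B ℤ}
    {φ : X.carrier → Y.carrier} (hφ : IsSlidingBlockCode φ) (k : ℤ) (x : X.carrier) :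
    φ (translate k x) = FutureCover.translate k (φ x) := by
  obtain ⟨K, hK⟩ := (isSlidingBlockCode_iff _).1 hφ
  ext i
  exact hK _ _ _ _ fun j _ _ => by simp [add_assoc]

theorem IsSlidingBlockCode.mem_unstableSet {X : Subshift A ℤ} {Y : Subshift B ℤ}
    {φ : X.carrier → Y.carrier} (hφ : IsSlidingBlockCode φ) {x z : X.carrier}
    (h : z ∈ unstableSet x) : φ z ∈ unstableSet (φ x) := by
  obtain ⟨K, hK⟩ := (isSlidingBlockCode_iff _).1 hφ
  obtain ⟨N, hN⟩ := h
  exact ⟨N - K, fun i hi => hK _ _ _ _ fun j _ _ => hN _ (by omega)⟩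

theorem translate_mem_unstableSet {X : Subshift A ℤ} {x z : X.carrier} (k : ℤ)
    (h : z ∈ unstableSet x) : translate k z ∈ unstableSet (translate k x) := by
  obtain ⟨N, hN⟩ := h
  exact ⟨N - k, fun i hi => hN _ (by omega)⟩

theorem translate_mem_regularPoints {X : Subshift A ℤ} {Y : Subshift B ℤ}
    {π : X.carrier → Y.carrier} (hπ : IsSlidingBlockCode π) {x : X.carrier}
    (hx : x ∈ regularPoints π) (k : ℤ) : translate k x ∈ regularPoints π := by
  intro y hy
  rw [hπ.translate] at hy
  have hy' : translate (-k) y ∈ unstableSet (π x) := by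
    convert translate_mem_unstableSet (-k) hy using 2
    ext i
    simp
  obtain ⟨u, hu, huy⟩ := hx hy'
  refine ⟨translate k u, translate_mem_unstableSet k hu, ?_⟩
  rw [hπ.translate, huy]
  ext i
  simp

/-- A morphism of sliding block codes over `Y` preserves regular points. -/
theorem IsSlidingBlockCode.map_regularPoints {X : Subshift A ℤ} {X' : Subshift B ℤ}
    {Y : Subshift C ℤ} {π : X.carrier → Y.carrier} {π' : X'.carrier → Y.carrier}
    {ρ : X.carrier → X'.carrier} (hρ : IsSlidingBlockCode ρ) (h : π' ∘ ρ = π) {x : X.carrier}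
    (hx : x ∈ regularPoints π) : ρ x ∈ regularPoints π' := by
  subst h
  intro y hy
  obtain ⟨u, hu, huy⟩ := hx hy
  exact ⟨ρ u, hρ.mem_unstableSet hu, huy⟩

/-- Points of a subshift of finite type that agree on a long enough block can be glued there. -/
theorem IsSFT.exists_glue {X : Subshift A ℤ} (hX : IsSFT X) :
    ∃ M : ℕ, ∀ N ≥ M, ∀ (x x' : X.carrier) (a : ℤ),
      (∀ j, a ≤ j → j ≤ a + N → x.1 j = x'.1 j) →
      ∃ u : X.carrier, (∀ j ≤ a + N, u.1 j = x.1 j) ∧ ∀ j ≥ a, u.1 j = x'.1 j := by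
  obtain ⟨F, hF, hXF⟩ := hX
  -- The overlap is at least as long as every forbidden word: an occurrence starting before `a` lies
  -- where the glued point equals `x`, any other where it equals `x'`.
  refine ⟨hF.toFinset.sup List.length, fun N hN x x' a h => ?_⟩
  have hu : (fun j => if j ≤ a + N then x.1 j else x'.1 j) ∈ X.carrier := by
    refine (Set.ext_iff.1 hXF _).2 ?_
    rintro w hw ⟨i, hi⟩
    have hlen : w.length ≤ hF.toFinset.sup List.length :=
      Finset.le_sup (f := List.length) (hF.mem_toFinset.2 hw)
    rcases le_or_gt a i with hai | hai
    · refine (Set.ext_iff.1 hXF _).1 x'.2 w hw ⟨i, fun k => ?_⟩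
      rw [← hi k]
      dsimp only
      split_ifs with hk
      · exact (h _ (by omega) hk).symm
      · rfl
    · refine (Set.ext_iff.1 hXF _).1 x.2 w hw ⟨i, fun k => ?_⟩
      have := k.2
      exact (if_pos (by omega)).symm.trans (hi k)
  refine ⟨⟨_, hu⟩, fun j hj => if_pos hj, fun j hj => ?_⟩
  dsimp only
  split_ifs with hk
  · exact h j hj hk
  · rfl

variable [DiscreteTopology A]

theorem dense_iff_window {X : Subshift A ℤ} (S : Set X.carrier) :
    Dense S ↔ ∀ (x : X.carrier) (N : ℕ),
      ∃ s ∈ S, ∀ j : ℤ, -N ≤ j → j ≤ N → s.1 j = x.1 j := by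
  constructor
  · intro h x N
    have ho : IsOpen (⋂ j ∈ Finset.Icc (-N : ℤ) N, {s : X.carrier | s.1 j = x.1 j}) := by
      refine isOpen_biInter_finset fun j _ => ?_
      have hc : Continuous fun s : X.carrier => s.1 j :=
        (continuous_apply j).comp continuous_subtype_val
      exact (isOpen_discrete {x.1 j}).preimage hc
    obtain ⟨s, hs, hsS⟩ := h.inter_open_nonempty _ ho ⟨x, by simp⟩
    refine ⟨s, hsS, fun j h1 h2 => ?_⟩
    simp only [Set.mem_iInter, Finset.mem_Icc] at hs
    exact hs j ⟨h1, h2⟩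
  · intro h x
    rw [mem_closure_iff]
    intro o ho hx
    obtain ⟨t, ht, rfl⟩ := isOpen_induced_iff.1 ho
    obtain ⟨I, v, hv, hsub⟩ := isOpen_pi_iff.1 ht x.1 hx
    obtain ⟨s, hs, hsx⟩ := h x (I.sup Int.natAbs)
    refine ⟨s, hsub fun j hj => ?_, hs⟩
    have : j.natAbs ≤ I.sup Int.natAbs := Finset.le_sup (f := Int.natAbs) hj
    rw [hsx j (by omega) (by omega)]
    exact (hv j hj).2

theorem IsSlidingBlockCode.eq_of_dense {X : Subshift A ℤ} {Y : Subshift B ℤ}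
    {φ ψ : X.carrier → Y.carrier} (hφ : IsSlidingBlockCode φ) (hψ : IsSlidingBlockCode ψ)
    {S : Set X.carrier} (hS : Dense S) (h : ∀ x ∈ S, φ x = ψ x) : φ = ψ := by
  obtain ⟨K, hK⟩ := (isSlidingBlockCode_iff _).1 hφ
  obtain ⟨L, hL⟩ := (isSlidingBlockCode_iff _).1 hψ
  funext x
  ext i
  obtain ⟨s, hs, hsx⟩ := (dense_iff_window S).1 hS x (i.natAbs + K + L)
  rw [← hK s x i i fun j _ _ => hsx _ (by omega) (by omega), h s hs]
  exact hL s x i i fun j _ _ => hsx _ (by omega) (by omega)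

/-- Every sequence of points of a subshift over a finite alphabet has a limit point, and the
subsequence agrees eventually with it at each position. -/
theorem exists_subseq_eventually_eq [Finite A] (X : Subshift A ℤ) (x : ℕ → X.carrier) :
    ∃ (y : X.carrier) (f : ℕ → ℕ), StrictMono f ∧
      ∀ j : ℤ, ∀ᶠ n in Filter.atTop, (x (f n)).1 j = y.1 j := by
  obtain ⟨y, hy, f, hf, hlim⟩ := X.isClosed.isCompact.tendsto_subseq fun n => (x n).2
  refine ⟨⟨y, hy⟩, f, hf, fun j => ?_⟩
  have := tendsto_pi_nhds.1 hlim j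
  rw [nhds_discrete, Filter.tendsto_pure] at this
  exact this

end Windows

/-! ### The future cover: canonical paths, right-closing, regular points. -/

section CoverProperties

variable {A B : Type u} [TopologicalSpace A] [TopologicalSpace B]

theorem mem_followerSet_shift {Y : Subshift A ℤ} {y : ℤ → A} {i : ℤ} {w : ℕ → A} :
    w ∈ followerSet Y (shift i y) ↔
      ∃ z : Y.carrier, (∀ j < i, z.1 j = y j) ∧ ∀ n : ℕ, z.1 (i + n) = w n := by
  constructor
  · rintro ⟨z, hz, h1, h2⟩
    refine ⟨translate (-i) ⟨z, hz⟩, fun j hj => ?_, fun n => ?_⟩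
    · have := h1 (-i + j) (by omega)
      simpa [shift_apply] using this
    · simpa using h2 n
  · rintro ⟨z, h1, h2⟩
    exact ⟨_, (translate i z).2, fun j hj => h1 _ (by omega), h2⟩

theorem mem_followerSet {Y : Subshift A ℤ} {y : ℤ → A} {w : ℕ → A} :
    w ∈ followerSet Y y ↔
      ∃ z : Y.carrier, (∀ j < 0, z.1 j = y j) ∧ ∀ n : ℕ, z.1 n = w n := by
  have : shift 0 y = y := by
    funext j
    simp [shift_apply]
  rw [← this, mem_followerSet_shift]
  simp

theorem followerSet_congr (Y : Subshift A ℤ) {y y' : ℤ → A} (h : ∀ j < 0, y j = y' j) :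
    followerSet Y y = followerSet Y y' := by
  ext w
  rw [mem_followerSet, mem_followerSet]
  refine exists_congr fun z => and_congr_left fun _ => forall₂_congr fun j hj => ?_
  rw [h j hj]

theorem followerSet_shift_add_one (Y : Subshift A ℤ) (y : ℤ → A) (i : ℤ) :
    followerSet Y (shift (i + 1) y) = letterQuotient (followerSet Y (shift i y)) (y i) := by
  ext w
  rw [letterQuotient, Set.mem_ofPred_eq, mem_followerSet_shift, mem_followerSet_shift]
  refine exists_congr fun z => ?_
  constructor
  · rintro ⟨h1, h2⟩
    refine ⟨fun j hj => h1 j (by omega), fun n => ?_⟩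
    cases n with
    | zero => simpa using h1 i (by omega)
    | succ n =>
      refine Eq.trans ?_ (h2 n)
      exact congrArg z.1 (by push_cast; ring)
  · rintro ⟨h1, h2⟩
    refine ⟨fun j hj => ?_, fun n => ?_⟩
    · rcases lt_or_eq_of_le (show j ≤ i by omega) with h | rfl
      · exact h1 j h
      · simpa using h2 0
    · have := h2 (n + 1)
      simp only at this
      rw [← this]
      exact congrArg z.1 (by push_cast; ring)

/-- The vertex `F(y)` of the future graph. -/
def followerVertex (Y : Subshift A ℤ) (y : Y.carrier) : (futureGraph Y).V :=
  ⟨followerSet Y y.1, y.1, y.2, rfl⟩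

/-- The arrow of the future graph from `F(y)` labeled `y₀`. -/
def followerEdge (Y : Subshift A ℤ) (y : Y.carrier) : (futureGraph Y).E :=
  ⟨(followerVertex Y y, y.1 0, followerVertex Y (translate 1 y)), by
    have := followerSet_shift_add_one Y y.1 0
    have h0 : shift 0 y.1 = y.1 := by
      funext j
      simp [shift_apply]
    rw [h0] at this
    exact this⟩

/-- The path through the follower sets of the left rays of `y`. -/
def followerPath (Y : Subshift A ℤ) (y : Y.carrier) : (futureGraph Y).edgeShift.carrier :=
  ⟨fun i => followerEdge Y (translate i y), fun i => by
    change followerVertex Y (translate (i + 1) y) = followerVertex Y (translate 1 (translate i y))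
    congr 1
    ext j
    simp [add_assoc]⟩

theorem s_followerPath (Y : Subshift A ℤ) (y : Y.carrier) (i : ℤ) :
    ((futureGraph Y).s ((followerPath Y y).1 i)).1 = followerSet Y (shift i y.1) := rfl

/-- The target is forced to be the quotient of the source by the label: the graph is deterministic.
-/
theorem futureGraph_edge_ext {Y : Subshift A ℤ} {e e' : (futureGraph Y).E}
    (hs : (futureGraph Y).s e = (futureGraph Y).s e')
    (hL : (futureGraph Y).L e = (futureGraph Y).L e') : e = e' := by
  obtain ⟨⟨v, a, v'⟩, h⟩ := e
  obtain ⟨⟨w, b, w'⟩, h'⟩ := e'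
  obtain rfl : v = w := hs
  obtain rfl : a = b := hL
  obtain rfl : v' = w' := Subtype.ext (h.trans h'.symm)
  rfl

/-- Paths in the future graph are determined to the right by a vertex and the labels. -/
theorem futureGraph_path_eq {Y : Subshift A ℤ} {e e' : ℤ → (futureGraph Y).E}
    (he : e ∈ (futureGraph Y).edgeShift.carrier) (he' : e' ∈ (futureGraph Y).edgeShift.carrier)
    {a : ℤ} (hs : (futureGraph Y).s (e a) = (futureGraph Y).s (e' a)) {b : ℤ}
    (hL : ∀ j, a ≤ j → j < b → (futureGraph Y).L (e j) = (futureGraph Y).L (e' j)) :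
    (∀ j, a ≤ j → j < b → e j = e' j) ∧
      (a ≤ b → (futureGraph Y).s (e b) = (futureGraph Y).s (e' b)) := by
  have key : ∀ n : ℕ, a + n ≤ b → (futureGraph Y).s (e (a + n)) = (futureGraph Y).s (e' (a + n)) := by
    intro n
    induction n with
    | zero => intro _; simpa using hs
    | succ n ih =>
      intro hn
      have h := futureGraph_edge_ext (ih (by omega)) (hL _ (by omega) (by omega))
      push_cast
      rw [← add_assoc, he, he', h]
  refine ⟨fun j h1 h2 => ?_, fun hab => ?_⟩
  · refine futureGraph_edge_ext ?_ (hL j h1 h2)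
    have := key (j - a).toNat (by omega)
    rwa [show a + ((j - a).toNat : ℤ) = j by omega] at this
  · have := key (b - a).toNat (by omega)
    rwa [show a + ((b - a).toNat : ℤ) = b by omega] at this

/-- Labels read along a path can be prepended to an element of a vertex. -/
theorem exists_prepend_mem (Y : Subshift A ℤ) (e : (futureGraph Y).edgeShift.carrier) (n : ℕ) :
    ∀ (i : ℤ), ∀ w ∈ ((futureGraph Y).s (e.1 i)).1,
      ∃ u ∈ ((futureGraph Y).s (e.1 (i - n))).1,
        (∀ k : ℕ, k < n → u k = (futureGraph Y).L (e.1 (i - n + k))) ∧ ∀ k, u (n + k) = w k := by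
  induction n with
  | zero => exact fun i w hw => ⟨w, by simpa using hw, by simp⟩
  | succ n ih =>
    intro i w hw
    obtain ⟨u, hu, h1, h2⟩ := ih i w hw
    have hi : i - n = i - (n + 1 : ℕ) + 1 := by push_cast; ring
    have hE : ((futureGraph Y).t (e.1 (i - (n + 1 : ℕ)))).1 = letterQuotient
      ((futureGraph Y).s (e.1 (i - (n + 1 : ℕ)))).1 ((futureGraph Y).L (e.1 (i - (n + 1 : ℕ)))) :=
      (e.1 _).2
    rw [hi, e.2, hE] at hu
    refine ⟨_, hu, fun k hk => ?_, fun k => ?_⟩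
    · cases k with
      | zero => simp
      | succ k =>
        simp only [h1 k (by omega)]
        exact congrArg (fun p => (futureGraph Y).L (e.1 p)) (by push_cast; ring)
    · rw [show n + 1 + k = (n + k) + 1 by ring]
      exact h2 k

variable [DiscreteTopology A]

theorem futureCover_followerPath (Y : Subshift A ℤ) (y : Y.carrier) :
    futureCover Y (followerPath Y y) = y := by
  ext i
  simp [futureCover, followerPath, followerEdge, futureGraph]

theorem futureCover_isSlidingBlockCode (Y : Subshift A ℤ) :
    IsSlidingBlockCode (futureCover Y) := by
  refine (isSlidingBlockCode_iff _).2 ⟨0, fun e e' i i' h => ?_⟩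
  have : e.1 i = e'.1 i' := by simpa using h 0
  simp [futureCover, this]

theorem futureCover_isFactorMap (Y : Subshift A ℤ) : IsFactorMap (futureCover Y) :=
  ⟨futureCover_isSlidingBlockCode Y, fun y => ⟨_, futureCover_followerPath Y y⟩⟩

theorem L_eq_of_futureCover_eq {Y : Subshift A ℤ} {e : (futureGraph Y).edgeShift.carrier}
    (i : ℤ) : (futureGraph Y).L (e.1 i) = (futureCover Y e).1 i := rfl

theorem path_eq_of_left {Y : Subshift A ℤ} {e e' : (futureGraph Y).edgeShift.carrier} {N : ℤ}
    (h : ∀ i ≤ N, e.1 i = e'.1 i) {b : ℤ}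
    (hL : ∀ j < b, (futureCover Y e).1 j = (futureCover Y e').1 j) :
    (∀ j < b, e.1 j = e'.1 j) ∧ (futureGraph Y).s (e.1 b) = (futureGraph Y).s (e'.1 b) := by
  -- The minimum keeps the starting position both inside the range of agreement and at most `b`.
  have key := futureGraph_path_eq e.2 e'.2 (a := min N b) (b := b)
    (by rw [h _ (by omega)]) (fun j _ hj => hL j hj)
  refine ⟨fun j hj => ?_, key.2 (by omega)⟩
  rcases le_total j N with hjN | hjN
  · exact h j hjN
  · exact key.1 j (by omega) hj

theorem futureCover_isRightClosing (Y : Subshift A ℤ) : IsRightClosing (futureCover Y) := by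
  rintro e e' ⟨N, hN⟩ h
  ext1
  funext i
  exact (path_eq_of_left hN (b := i + 1) fun j _ => by rw [h]).1 i (by omega)

theorem followerPath_mem_regularPoints (Y : Subshift A ℤ) (y : Y.carrier) :
    followerPath Y y ∈ regularPoints (futureCover Y) := by
  rintro z ⟨N, hN⟩
  rw [futureCover_followerPath] at hN
  refine ⟨followerPath Y z, ⟨N, fun i hi => ?_⟩, futureCover_followerPath Y z⟩
  refine futureGraph_edge_ext (Subtype.ext ?_) ?_
  · rw [s_followerPath, s_followerPath]
    exact followerSet_congr Y fun j hj => hN _ (by omega)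
  · rw [L_eq_of_futureCover_eq, L_eq_of_futureCover_eq, futureCover_followerPath,
      futureCover_followerPath]
    exact hN i hi

variable [Finite A]

/-- Follower sets are closed. -/
theorem mem_followerSet_shift_of_forall (Y : Subshift A ℤ) (y : ℤ → A) (i : ℤ) (w : ℕ → A)
    (h : ∀ n : ℕ, ∃ z : Y.carrier, (∀ j < i, i - n ≤ j → z.1 j = y j) ∧
      ∀ k : ℕ, k < n → z.1 (i + k) = w k) : w ∈ followerSet Y (shift i y) := by
  -- The approximants match only `n` letters on each side of `i`; a limit point matches both rays
  -- entirely.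
  choose z h1 h2 using h
  obtain ⟨z', f, hf, hz⟩ := exists_subseq_eventually_eq Y z
  refine mem_followerSet_shift.2 ⟨z', fun j hj => ?_, fun k => ?_⟩
  · obtain ⟨n, hn, hn'⟩ := ((hz j).and (Filter.eventually_ge_atTop (i - j).toNat)).exists
    have := hf.le_apply (x := n)
    rw [← hn, h1 _ j hj (by omega)]
  · obtain ⟨n, hn, hn'⟩ := ((hz (i + k)).and (Filter.eventually_ge_atTop (k + 1))).exists
    have := hf.le_apply (x := n)
    rw [← hn, h2 _ k (by omega)]

/-- The vertex where a path stands is contained in the follower set of the labels to its left. -/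
theorem vertex_subset_followerSet (Y : Subshift A ℤ) (e : (futureGraph Y).edgeShift.carrier)
    (i : ℤ) : ((futureGraph Y).s (e.1 i)).1 ⊆ followerSet Y (shift i (futureCover Y e).1) := by
  intro w hw
  refine mem_followerSet_shift_of_forall _ _ _ _ fun n => ?_
  obtain ⟨u, hu, h1, h2⟩ := exists_prepend_mem Y e n i w hw
  obtain ⟨y, hy, hyv⟩ := ((futureGraph Y).s (e.1 (i - n))).2
  rw [← hyv, mem_followerSet] at hu
  obtain ⟨z, -, hz⟩ := hu
  refine ⟨translate (-(i - n)) z, fun j hj hnj => ?_, fun k _ => ?_⟩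
  · have h3 := h1 (j - (i - n)).toNat (by omega)
    have e1 : (((j - (i - n)).toNat : ℕ) : ℤ) = -(i - n) + j := by omega
    rw [← hz, e1, show i - n + (-(i - n) + j) = j by ring] at h3
    exact h3
  · have h3 := h2 k
    rw [← hz] at h3
    rw [translate_val, ← h3]
    exact congrArg z.1 (by push_cast; ring)

/-- The labels of a path, read from a vertex onwards, belong to that vertex. -/
theorem label_mem_vertex (Y : Subshift A ℤ) (e : (futureGraph Y).edgeShift.carrier) (i : ℤ) :
    (fun n : ℕ => (futureCover Y e).1 (i + n)) ∈ ((futureGraph Y).s (e.1 i)).1 := by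
  obtain ⟨y, hy, hyv⟩ := ((futureGraph Y).s (e.1 i)).2
  have h0 : shift 0 y = y := by
    funext j
    simp [shift_apply]
  rw [← hyv, ← h0]
  refine mem_followerSet_shift_of_forall _ _ _ _ fun n => ?_
  obtain ⟨w, hw, hk⟩ := exists_mem_vertex Y e.1 e.2 n i
  rw [← hyv, mem_followerSet] at hw
  obtain ⟨z, h1, h2⟩ := hw
  refine ⟨z, fun j hj _ => h1 j hj, fun k hkn => ?_⟩
  rw [zero_add, h2, hk k hkn]
  rfl

theorem eq_followerPath_of_mem_regularPoints {Y : Subshift A ℤ}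
    {e : (futureGraph Y).edgeShift.carrier} (he : e ∈ regularPoints (futureCover Y)) :
    e = followerPath Y (futureCover Y e) := by
  ext1
  funext i
  refine futureGraph_edge_ext (Subtype.ext ?_) ?_
  · rw [s_followerPath]
    refine (vertex_subset_followerSet Y e i).antisymm fun w hw => ?_
    obtain ⟨z, h1, h2⟩ := mem_followerSet_shift.1 hw
    -- Regularity lifts `z` to a path `e'` that agrees with `e` far to the left. Equal labels before
    -- `i` lead both to the same vertex at `i`, which contains the labels `w` that `e'` reads from
    -- there.
    obtain ⟨e', ⟨N, hN⟩, rfl⟩ := he ⟨i - 1, fun j hj => h1 j (by omega)⟩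
    have := label_mem_vertex Y e' i
    rw [(path_eq_of_left hN (b := i) h1).2] at this
    convert this using 1
    funext n
    exact (h2 n).symm
  · rw [L_eq_of_futureCover_eq, L_eq_of_futureCover_eq, futureCover_followerPath]

theorem futureCover_injOn_regularPoints (Y : Subshift A ℤ) :
    Set.InjOn (futureCover Y) (regularPoints (futureCover Y)) := by
  intro e he e' he' h
  rw [eq_followerPath_of_mem_regularPoints he, h, ← eq_followerPath_of_mem_regularPoints he']

/-- The vertex at `-N` is some `F(y)` and contains the labels of `e` from there on. Joining the left
ray of `y` to these labels gives a point of `Y` whose canonical path, suitably shifted, follows `e`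
from `-N` onwards. -/
theorem futureCover_isRegular (Y : Subshift A ℤ) : IsRegular (futureCover Y) := by
  refine (dense_iff_window _).2 fun e N => ?_
  obtain ⟨y, hy, hyv⟩ := ((futureGraph Y).s (e.1 (-N))).2
  have hw := label_mem_vertex Y e (-N)
  rw [← hyv, mem_followerSet] at hw
  obtain ⟨z, h1, h2⟩ := hw
  refine ⟨_, followerPath_mem_regularPoints Y (translate N z), fun j hj _ => ?_⟩
  refine (futureGraph_path_eq (followerPath Y (translate N z)).2 e.2 (a := -N) (b := j + 1)
    (Subtype.ext ?_) fun k hk _ => ?_).1 j hj (by omega)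
  · rw [s_followerPath, ← hyv]
    exact followerSet_congr Y fun j hj => by
      simpa [shift_apply, translate] using h1 j hj
  · rw [L_eq_of_futureCover_eq, L_eq_of_futureCover_eq, futureCover_followerPath, translate_val]
    have := h2 (N + k).toNat
    rw [show (((N + k).toNat : ℕ) : ℤ) = N + k by omega] at this
    simpa using this

end CoverProperties

/-! ### Finiteness of the graph over a factor of an SFT. -/

section Finiteness

variable {A B : Type u} [TopologicalSpace A] [TopologicalSpace B]

/-- The central words of length `2K + 1` of the points whose images continue the left ray of `y`. -/
def centralWords {X : Subshift B ℤ} {Y : Subshift A ℤ} (π : X.carrier → Y.carrier) (K : ℕ)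
    (y : ℤ → A) : Set (Fin (2 * K + 1) → B) :=
  {u | ∃ x : X.carrier, (∀ j < 0, (π x).1 j = y j) ∧ block x.1 (-K) (2 * K + 1) = u}

theorem eq_of_block_eq {B : Type u} {x x' : ℤ → B} {K : ℕ}
    (h : block x (-K) (2 * K + 1) = block x' (-K) (2 * K + 1)) {j : ℤ} (h1 : -K ≤ j)
    (h2 : j ≤ K) : x j = x' j := by
  have := congrFun h ⟨(j + K).toNat, by omega⟩
  simp only [block] at this
  rwa [show -(K : ℤ) + ((j + K).toNat : ℕ) = j by omega] at this

/-- Over a factor of a subshift of finite type, central words determine the follower set. -/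
theorem exists_followerSet_subset {X : Subshift B ℤ} {Y : Subshift A ℤ}
    {π : X.carrier → Y.carrier} (hX : IsSFT X) (hπ : IsFactorMap π) :
    ∃ K : ℕ, ∀ y y' : ℤ → A, centralWords π K y ⊆ centralWords π K y' →
      followerSet Y y ⊆ followerSet Y y' := by
  obtain ⟨r, hr⟩ := (isSlidingBlockCode_iff _).1 hπ.1
  obtain ⟨M, hM⟩ := hX.exists_glue
  refine ⟨M + r, fun y y' h w hw => ?_⟩
  obtain ⟨z, h1, h2⟩ := mem_followerSet.1 hw
  obtain ⟨x, rfl⟩ := hπ.2 z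
  obtain ⟨x', h1', hb⟩ := h ⟨x, h1, rfl⟩
  -- The glued point has the past of `x'` and the future of `x`. The overlap reaches `r` past the
  -- origin on both sides, so its image has the past of `y'` and the future `w`.
  obtain ⟨u, hu1, hu2⟩ := hM (2 * (M + r)) (by omega) x' x (-(M + r : ℕ))
    fun j h3 h4 => eq_of_block_eq hb h3 (by push_cast at h4 ⊢; omega)
  refine mem_followerSet.2 ⟨π u, fun j hj => ?_, fun n => ?_⟩
  · rw [← h1' j hj]
    exact hr _ _ _ _ fun k _ _ => hu1 _ (by push_cast; omega)
  · rw [← h2 n]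
    exact hr _ _ _ _ fun k _ _ => hu2 _ (by push_cast; omega)

theorem finite_futureGraph_V [Finite B] {X : Subshift B ℤ} {Y : Subshift A ℤ}
    {π : X.carrier → Y.carrier} (hX : IsSFT X) (hπ : IsFactorMap π) :
    Finite (futureGraph Y).V := by
  obtain ⟨K, hK⟩ := exists_followerSet_subset hX hπ
  choose y hy hyv using fun v : (futureGraph Y).V => v.2
  refine Finite.of_injective (fun v => centralWords π K (y v)) fun v v' h => Subtype.ext ?_
  rw [← hyv v, ← hyv v']
  exact (hK _ _ h.subset).antisymm (hK _ _ h.superset)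

theorem finite_futureGraph_E [Finite A] {Y : Subshift A ℤ} [Finite (futureGraph Y).V] :
    Finite (futureGraph Y).E :=
  Finite.of_injective
    (fun e : (futureGraph Y).E => ((futureGraph Y).s e, (futureGraph Y).L e)) fun _ _ h =>
      futureGraph_edge_ext (Prod.mk.inj h).1 (Prod.mk.inj h).2

theorem LabeledGraph.isSFT_edgeShift {A : Type u} (G : LabeledGraph A) [Finite G.E] :
    IsSFT G.edgeShift := by
  refine ⟨(fun p : G.E × G.E => [p.1, p.2]) '' {p | G.s p.2 ≠ G.t p.1},
    (Set.toFinite _).image _, ?_⟩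
  ext e
  constructor
  · rintro he _ ⟨⟨p, q⟩, hpq, rfl⟩ ⟨i, hi⟩
    have h0 := hi ⟨0, by simp⟩
    have h1 := hi ⟨1, by simp⟩
    simp only [Nat.cast_zero, add_zero, Nat.cast_one, List.get_eq_getElem,
      List.getElem_cons_zero, List.getElem_cons_succ] at h0 h1
    exact hpq (h0 ▸ h1 ▸ he i)
  · intro h i
    by_contra hne
    refine h _ ⟨(e i, e (i + 1)), hne, rfl⟩ ⟨i, fun k => ?_⟩
    obtain ⟨k, hk⟩ := k
    have hk' : k < 2 := hk
    interval_cases k <;> simp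

end Finiteness

/-! ### Right-closing with delay, and minimality of the future cover. -/

section Minimality

variable {A B D : Type u} [TopologicalSpace A] [TopologicalSpace B] [TopologicalSpace D]

/-- A right-closing code over finite alphabets is right-closing with a uniform delay. -/
theorem IsRightClosing.exists_delay [Finite D] [DiscreteTopology D] {X : Subshift D ℤ}
    {Y : Subshift A ℤ} {π : X.carrier → Y.carrier} (hπ : IsSlidingBlockCode π)
    (hrc : IsRightClosing π) :
    ∃ l : ℕ, ∀ x x' : X.carrier, (∀ j : ℤ, -l ≤ j → j < 0 → x.1 j = x'.1 j) →
      (∀ j : ℤ, -l ≤ j → j ≤ l → (π x).1 j = (π x').1 j) → x.1 0 = x'.1 0 := by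
  -- Compactness: a limit of counterexamples with growing `l` is a pair with equal images and equal
  -- left rays, yet differing at `0`.
  by_contra! hcon
  choose x x' h1 h2 h3 using hcon
  obtain ⟨r, hr⟩ := (isSlidingBlockCode_iff _).1 hπ
  obtain ⟨p, f, hf, hp⟩ := exists_subseq_eventually_eq X x
  obtain ⟨p', g, hg, hp'⟩ := exists_subseq_eventually_eq X (x' ∘ f)
  have hfg : ∀ n, n ≤ f (g n) := fun n => (hf.comp hg).le_apply
  have hp2 : ∀ j, ∀ᶠ n in Filter.atTop, (x (f (g n))).1 j = p.1 j := fun j =>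
    hg.tendsto_atTop.eventually (hp j)
  have hpp : p = p' := by
    refine hrc p p' ⟨-1, fun j hj => ?_⟩ ?_
    · obtain ⟨n, ⟨ha, hb⟩, hn⟩ :=
        (((hp2 j).and (hp' j)).and (Filter.eventually_ge_atTop (-j).toNat)).exists
      have := hfg n
      rw [← ha, ← hb]
      exact h1 _ j (by omega) (by omega)
    · ext i
      have ev : ∀ᶠ n in Filter.atTop, ∀ j ∈ Finset.Icc (-r : ℤ) r,
          (x (f (g n))).1 (i + j) = p.1 (i + j) ∧ (x' (f (g n))).1 (i + j) = p'.1 (i + j) := by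
        rw [Filter.eventually_all_finset]
        exact fun j _ => (hp2 _).and (hp' _)
      obtain ⟨n, ha, hn⟩ := (ev.and (Filter.eventually_ge_atTop i.natAbs)).exists
      have := hfg n
      rw [← hr _ _ i i fun j hj hj' => (ha j (Finset.mem_Icc.2 ⟨hj, hj'⟩)).1,
        ← hr _ _ i i fun j hj hj' => (ha j (Finset.mem_Icc.2 ⟨hj, hj'⟩)).2]
      exact h2 _ i (by omega) (by omega)
  obtain ⟨n, ha, hb⟩ := ((hp2 0).and (hp' 0)).exists
  exact h3 (f (g n)) (by rw [ha, hpp]; exact hb.symm)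

/-- Agreement far to the left spreads rightwards letter by letter. Each letter needs the next `l`
image letters, known to agree only before `0`, so the process stops at `-l`. -/
theorem IsRightClosing.exists_eq_of_left [Finite D] [DiscreteTopology D] {X : Subshift D ℤ}
    {Y : Subshift A ℤ} {π : X.carrier → Y.carrier} (hπ : IsSlidingBlockCode π)
    (hrc : IsRightClosing π) :
    ∃ l : ℕ, ∀ x u : X.carrier, u ∈ unstableSet x → (∀ j < 0, (π u).1 j = (π x).1 j) →
      ∀ j < -(l : ℤ), u.1 j = x.1 j := by
  obtain ⟨l, hl⟩ := hrc.exists_delay hπ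
  refine ⟨l, ?_⟩
  rintro x u ⟨N, hN⟩ h
  have key : ∀ n : ℕ, ∀ j ≤ N + n, j < -(l : ℤ) → u.1 j = x.1 j := by
    intro n
    induction n with
    | zero => exact fun j hj _ => hN j (by simpa using hj)
    | succ n ih =>
      intro j hj hjl
      have := hl (translate j u) (translate j x)
        (fun k _ hk => ih _ (by push_cast at hj; omega) (by omega)) fun k _ hk => by
          rw [hπ.translate, hπ.translate]
          exact h _ (by omega)
      simpa using this
  exact fun j hj => key (j - N).toNat j (by omega) hj

/-- For a regular right-closing code on a subshift of finite type, the follower set of the image of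
a regular point depends only on a window. -/
theorem exists_followerSet_eq_of_window [Finite D] [DiscreteTopology D] {X : Subshift D ℤ}
    {Y : Subshift A ℤ} {π : X.carrier → Y.carrier} (hX : IsSFT X) (hπ : IsSlidingBlockCode π)
    (hrc : IsRightClosing π) :
    ∃ K : ℕ, ∀ x ∈ regularPoints π, ∀ x' ∈ regularPoints π,
      (∀ j : ℤ, -K ≤ j → j ≤ K → x.1 j = x'.1 j) →
      followerSet Y (π x).1 = followerSet Y (π x').1 := by
  obtain ⟨l, hl⟩ := hrc.exists_eq_of_left hπ
  obtain ⟨r, hr⟩ := (isSlidingBlockCode_iff _).1 hπ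
  obtain ⟨M, hM⟩ := hX.exists_glue
  -- Besides the `M` needed for gluing, `2 * r` makes every window of radius `r` lie wholly in the
  -- part of the glued point copied from `x'` or in the part copied from `u`.
  let N := M + 2 * r
  suffices hsub : ∀ x ∈ regularPoints π, ∀ x' : X.carrier,
      (∀ j : ℤ, -(l + N + 1 + r : ℕ) ≤ j → j ≤ (l + N + 1 + r : ℕ) → x.1 j = x'.1 j) →
      followerSet Y (π x).1 ⊆ followerSet Y (π x').1 from
    ⟨l + N + 1 + r, fun x hx x' hx' h => (hsub x hx x' h).antisymm
      (hsub x' hx' x fun j h1 h2 => (h j h1 h2).symm)⟩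
  intro x hx x' h w hw
  obtain ⟨z, h1, h2⟩ := mem_followerSet.1 hw
  obtain ⟨u, hu, rfl⟩ := hx ⟨-1, fun j hj => h1 j (by omega)⟩
  have hux := hl x u hu h1
  obtain ⟨v, hv1, hv2⟩ := hM N (by omega) x' u (-l - N - 1) fun j h3 h4 => by
    rw [hux j (by omega), h j (by push_cast; omega) (by push_cast; omega)]
  refine mem_followerSet.2 ⟨π v, fun j hj => ?_, fun n => ?_⟩
  · rcases le_or_gt (j + r) (-l - 1) with hjr | hjr
    · exact hr _ _ _ _ fun k _ _ => hv1 _ (by omega)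
    · rw [hr v u j j fun k _ _ => hv2 _ (by omega), h1 j hj]
      exact hr _ _ _ _ fun k _ _ => h _ (by push_cast; omega) (by push_cast; omega)
  · rw [← h2 n]
    exact hr _ _ _ _ fun k _ _ => hv2 _ (by omega)

/-- The future cover is minimal among regular right-closing factor maps. -/
theorem futureCover_isMinimal [DiscreteTopology A] (Y : Subshift A ℤ) :
    IsMinimalAmongRegularRightClosing (futureCover Y) := by
  intro D _ _ _ X π hX hπ hreg hrc
  obtain ⟨K, hK⟩ := exists_followerSet_eq_of_window hX hπ.1 hrc
  obtain ⟨r, hr⟩ := (isSlidingBlockCode_iff _).1 hπ.1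
  -- Radius `K` fixes the follower set and `r` the label; the extra `1` allows the approximant at
  -- `i`, shifted once, to be compared with the one at `i + 1`.
  have happ : ∀ (x : X.carrier) (i : ℤ), ∃ s ∈ regularPoints π, ∀ j : ℤ,
      -(K + r + 1 : ℕ) ≤ j → j ≤ (K + r + 1 : ℕ) → s.1 j = x.1 (i + j) := fun x i =>
    (dense_iff_window _).1 hreg (translate i x) (K + r + 1)
  choose s hs hsx using happ
  have hL : ∀ x i, (π (s x i)).1 0 = (π x).1 i := fun x i =>
    hr _ _ _ _ fun j _ _ => by
      rw [zero_add, hsx _ _ _ (by push_cast; omega) (by push_cast; omega)]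
  have hV : ∀ x i, followerVertex Y (π (s x (i + 1))) =
      followerVertex Y (translate 1 (π (s x i))) := fun x i => by
    refine Subtype.ext ?_
    rw [← hπ.1.translate]
    refine hK _ (hs _ _) _ (translate_mem_regularPoints hπ.1 (hs _ _) 1) fun j h1 h2 => ?_
    rw [translate_val, hsx _ _ _ (by push_cast; omega) (by push_cast; omega),
      hsx _ _ _ (by push_cast; omega) (by push_cast; omega), add_assoc]
  let ρ : X.carrier → (futureGraph Y).edgeShift.carrier := fun x =>
    ⟨fun i => followerEdge Y (π (s x i)), hV x⟩
  refine ⟨ρ, (isSlidingBlockCode_iff _).2 ⟨K + r + 1, fun x x' i i' h => ?_⟩, ?_⟩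
  · refine futureGraph_edge_ext (Subtype.ext ?_) ?_
    · refine hK _ (hs _ _) _ (hs _ _) fun j h1 h2 => ?_
      rw [hsx _ _ _ (by push_cast; omega) (by push_cast; omega),
        hsx _ _ _ (by push_cast; omega) (by push_cast; omega)]
      exact h j (by push_cast; omega) (by push_cast; omega)
    · change (π (s x i)).1 0 = (π (s x' i')).1 0
      rw [hL, hL]
      exact hr _ _ _ _ fun j _ _ => h j (by push_cast; omega) (by push_cast; omega)
  · funext x
    ext i
    exact hL x i

end Minimality

/-! ### Invariance under isomorphism, and isomorphism from mutual factorization. -/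

section Transfer

variable {A B C : Type u} [TopologicalSpace A] [TopologicalSpace B] [TopologicalSpace C]
  {X : Subshift B ℤ} {X' : Subshift C ℤ} {Y : Subshift A ℤ}
  {π : X.carrier → Y.carrier} {π' : X'.carrier → Y.carrier}

/-- Regularity, right-closingness, injectivity on regular points and minimality are invariant under
isomorphism. -/
theorem AreIsomorphic.transfer [DiscreteTopology B] [DiscreteTopology C]
    (h : AreIsomorphic π π')
    (hreg : IsRegular π') (hrc : IsRightClosing π') (hinj : Set.InjOn π' (regularPoints π'))
    (hmin : IsMinimalAmongRegularRightClosing π') :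
    IsRegular π ∧ IsRightClosing π ∧ Set.InjOn π (regularPoints π) ∧
      IsMinimalAmongRegularRightClosing π := by
  obtain ⟨χ, ⟨hχ, ψ, hψ, hl, hr⟩, rfl⟩ := h
  have hψπ : (π' ∘ χ) ∘ ψ = π' := funext fun x => congrArg π' (hr x)
  refine ⟨(dense_iff_window _).2 fun x N => ?_, ?_, ?_, ?_⟩
  · obtain ⟨K, hK⟩ := (isSlidingBlockCode_iff _).1 hψ
    obtain ⟨s, hs, hsx⟩ := (dense_iff_window _).1 hreg (χ x) (N + K)
    refine ⟨ψ s, hψ.map_regularPoints hψπ hs, fun j _ _ => ?_⟩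
    conv_rhs => rw [← hl x]
    exact hK _ _ _ _ fun k _ _ => hsx _ (by push_cast; omega) (by push_cast; omega)
  · intro x x' hx h
    exact hl.injective (hrc _ _ (hχ.mem_unstableSet (x := x') hx) h)
  · intro x hx x' hx' h
    exact hl.injective (hinj (hχ.map_regularPoints rfl hx) (hχ.map_regularPoints rfl hx') h)
  · intro D _ _ _ Z p hZ hp hpr hpc
    obtain ⟨ρ, hρ, rfl⟩ := hmin D Z p hZ hp hpr hpc
    exact ⟨ψ ∘ ρ, hψ.comp hρ, by rw [← Function.comp_assoc, hψπ]⟩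

/-- Regular maps that are injective on their regular points and factor through each other are
isomorphic. -/
theorem areIsomorphic_of_factor [DiscreteTopology B] [DiscreteTopology C]
    (hreg : IsRegular π) (hinj : Set.InjOn π (regularPoints π))
    (hreg' : IsRegular π') (hinj' : Set.InjOn π' (regularPoints π'))
    {ρ : X.carrier → X'.carrier} (hρ : IsSlidingBlockCode ρ) (h : π' ∘ ρ = π)
    {ρ' : X'.carrier → X.carrier} (hρ' : IsSlidingBlockCode ρ') (h' : π ∘ ρ' = π') :
    AreIsomorphic π π' := by
  refine ⟨ρ, ⟨hρ, ρ', hρ', ?_, ?_⟩, h⟩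
  · refine congrFun ((hρ'.comp hρ).eq_of_dense isSlidingBlockCode_id hreg fun x hx => ?_)
    refine hinj (hρ'.map_regularPoints h' (hρ.map_regularPoints h hx)) hx ?_
    exact (congrFun h' (ρ x)).trans (congrFun h x)
  · refine congrFun ((hρ.comp hρ').eq_of_dense isSlidingBlockCode_id hreg' fun x hx => ?_)
    refine hinj' (hρ.map_regularPoints h (hρ'.map_regularPoints h' hx)) hx ?_
    exact (congrFun h (ρ' x)).trans (congrFun h' x)

end Transfer

end FutureCover

theorem proposition3p9 {A B : Type u} [Finite A] [TopologicalSpace A] [DiscreteTopology A]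
    [Finite B] [TopologicalSpace B] [DiscreteTopology B]
    (X : Subshift B ℤ) (Y : Subshift A ℤ) (π : X.carrier → Y.carrier)
    (hX : FutureCover.IsSFT X) (hπ : FutureCover.IsFactorMap π) :
    FutureCover.AreIsomorphic π (FutureCover.futureCover Y) ↔
      FutureCover.IsRegular π ∧
      FutureCover.IsRightClosing π ∧
      Set.InjOn π (FutureCover.regularPoints π) ∧
      FutureCover.IsMinimalAmongRegularRightClosing π := by
  have hreg := FutureCover.futureCover_isRegular Y
  have hinj := FutureCover.futureCover_injOn_regularPoints Y
  have hrc := FutureCover.futureCover_isRightClosing Y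
  have hmin := FutureCover.futureCover_isMinimal Y
  refine ⟨fun h => h.transfer hreg hrc hinj hmin, ?_⟩
  rintro ⟨ha, hb, hc, hd⟩
  -- Minimality of `π` applies only to SFTs over finite alphabets, so the graph must first be shown
  -- finite.
  have := FutureCover.finite_futureGraph_V hX hπ
  have := FutureCover.finite_futureGraph_E (Y := Y)
  obtain ⟨ρ, hρ, h⟩ := hmin B X π hX hπ ha hb
  obtain ⟨ρ', hρ', h'⟩ := hd _ _ _ (FutureCover.futureGraph Y).isSFT_edgeShift
    (FutureCover.futureCover_isFactorMap Y) hreg hrc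
  exact FutureCover.areIsomorphic_of_factor ha hc hreg hinj hρ h hρ' h'
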